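/- Let $n\ge 0$ and, for a closed convex nonempty set $C\subseteq\mathbb{R}^n$, let $\Pi_C(x)=\operatorname{argmin}_{z\in C}\|x-z\|^2$ denote the Euclidean projection onto $C$. For a closed convex cone $T\subseteq\mathbb{R}^m$ let $\delta(T)=\mathbb{E}\|\Pi_T(Z)\|^2$ with $Z\sim N(0,I_m)$ be its statistical dimension. Let $\mathcal{S}^n=\{u\in\mathbb{R}^n: u_1\le\dots\le u_n\}$ be the monotone cone. A block is a nonempty set of consecutive integers, and partitions into blocks are listed in increasing order. For a partition of $\{1,\dots,m\}$ into blocks $I_1,\dots,I_p$, the block monotone cone is $$\mathcal{S}_{|I_1|,\dots,|I_p|}=\{u\in\mathcal{S}^m: u\text{ is constant on each of } I_1,\dots,I_p\}.$$ Let $\theta^*\in\mathbb{R}^n$ and, for $\sigma>0$, let $Y=\theta^*+\sigma Z\sim N(\theta^*,\sigma^2 I_n)$ with $Z\sim N(0,I_n)$, and $\hat\theta(Y)=\Pi_{\mathcal{S}^n}(Y)$. There is a unique partition $(J_1,\dots,J_K)$ of $\{1,\dots,n\}$ into blocks such that $\Pi_{\mathcal{S}^n}(\theta^*)$ is constant on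 each $J_k$, with values $\mu_1<\dots<\mu_K$. For each $k\in\{1,\dots,K\}$, among all partitions of $J_k$ into blocks on each of which the mean of the components of $\theta^*$ equals $\mu_k$, there is a unique finest one $(I^k_1,\dots,I^k_{m_k})$, i.e. one that refines all the others; in particular $$\frac{1}{|I^k_j|}\sum_{i\in I^k_j}\theta^*_i=\mu_k,\qquad 1\le j\le m_k.$$ Moreover, the normalized excess risk and the normalized misspecified risk of $\hat\theta$ have the same low $\sigma$ limit: $$\lim_{\sigma\downarrow0}\frac{1}{\sigma^2}\Bigl(\mathbb{E}\|\hat\theta(Y)-\theta^*\|^2-\|\Pi_{\mathcal{S}^n}(\theta^*)-\theta^*\|^2\Bigr) =\lim_{\sigma\downarrow0}\frac{1}{\sigma^2}\,\mathbb{E}\|\hat\theta(Y)-\Pi_{\mathcal{S}^n}(\theta^*)\|^2 =\sum_{k=1}^K\delta\bigl(\mathcal{S}_{|I^k_1|,\dots,|I^k_{m_k}|}\bigr).$$ -/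

import Mathlib

open MeasureTheory ProbabilityTheory Filter Topology

namespace Isotonic

noncomputable section

/-- The least squares projection `argmin_{z ∈ C} ‖x - z‖²`. The minimizer exists and is unique
whenever `C` is nonempty, closed and convex, see `proj_mem_isMinOn` and `eq_proj`. -/
def proj {n : ℕ} (C : Set (EuclideanSpace ℝ (Fin n))) (x : EuclideanSpace ℝ (Fin n)) :
    EuclideanSpace ℝ (Fin n) :=
  Classical.epsilon fun p => p ∈ C ∧ IsMinOn (fun z => ‖x - z‖ ^ 2) C p

theorem proj_mem_isMinOn {n : ℕ} {C : Set (EuclideanSpace ℝ (Fin n))} (hne : C.Nonempty)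
    (hcl : IsClosed C) (x : EuclideanSpace ℝ (Fin n)) :
    proj C x ∈ C ∧ IsMinOn (fun z => ‖x - z‖ ^ 2) C (proj C x) := by
  apply Classical.epsilon_spec (p := fun p => p ∈ C ∧ IsMinOn (fun z => ‖x - z‖ ^ 2) C p)
  obtain ⟨p, hp, h⟩ := hcl.exists_infDist_eq_dist hne x
  refine ⟨p, hp, fun z hz => ?_⟩
  have h1 : ‖x - p‖ ≤ ‖x - z‖ := by
    rw [← dist_eq_norm, ← dist_eq_norm, ← h]
    exact Metric.infDist_le_dist_of_mem hz
  exact pow_le_pow_left₀ (norm_nonneg _) h1 2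

theorem eq_proj {n : ℕ} {C : Set (EuclideanSpace ℝ (Fin n))} (hcl : IsClosed C)
    (hconv : Convex ℝ C) {x p : EuclideanSpace ℝ (Fin n)} (hp : p ∈ C)
    (hmin : IsMinOn (fun z => ‖x - z‖ ^ 2) C p) : p = proj C x := by
  obtain ⟨hq, hqmin⟩ := proj_mem_isMinOn ⟨p, hp⟩ hcl x
  generalize proj C x = q at *
  have hmid : (1 / 2 : ℝ) • p + (1 / 2 : ℝ) • q ∈ C :=
    hconv hp hq (by norm_num) (by norm_num) (by norm_num)
  have h1 : ‖x - p‖ ^ 2 ≤ ‖x - ((1 / 2 : ℝ) • p + (1 / 2 : ℝ) • q)‖ ^ 2 := hmin hmid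
  have h2 : ‖x - q‖ ^ 2 ≤ ‖x - ((1 / 2 : ℝ) • p + (1 / 2 : ℝ) • q)‖ ^ 2 := hqmin hmid
  have hpar := parallelogram_law_with_norm ℝ (x - p) (x - q)
  have e1 : (x - p) + (x - q) = (2 : ℝ) • (x - ((1 / 2 : ℝ) • p + (1 / 2 : ℝ) • q)) := by
    module
  have e2 : (x - p) - (x - q) = q - p := by abel
  rw [e1, e2, norm_smul, Real.norm_ofNat] at hpar
  have h3 : ‖q - p‖ = 0 := by
    have := norm_nonneg (q - p)
    nlinarith
  exact (sub_eq_zero.mp (norm_eq_zero.mp h3)).symm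

/-- The statistical dimension `δ(T) = E ‖Π_T(Z)‖²` of a closed cone, with `Z ∼ N(0, I_n)`. -/
def statDim {n : ℕ} (T : Set (EuclideanSpace ℝ (Fin n))) : ℝ :=
  ∫ z, ‖proj T z‖ ^ 2 ∂(stdGaussian (EuclideanSpace ℝ (Fin n)))

/-- The misspecified risk `E ‖Π_C(Y) - Π_C(θ)‖²`, where `Y = θ + σ Z` and `Z ∼ N(0, I_n)`. -/
def misspecifiedRisk {n : ℕ} (C : Set (EuclideanSpace ℝ (Fin n)))
    (θ : EuclideanSpace ℝ (Fin n)) (σ : ℝ) : ℝ :=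
  ∫ z, ‖proj C (θ + σ • z) - proj C θ‖ ^ 2 ∂(stdGaussian (EuclideanSpace ℝ (Fin n)))

/-- The excess risk `E ‖Π_C(Y) - θ‖² - ‖Π_C(θ) - θ‖²`, where `Y = θ + σ Z` and
`Z ∼ N(0, I_n)`. -/
def excessRisk {n : ℕ} (C : Set (EuclideanSpace ℝ (Fin n)))
    (θ : EuclideanSpace ℝ (Fin n)) (σ : ℝ) : ℝ :=
  (∫ z, ‖proj C (θ + σ • z) - θ‖ ^ 2 ∂(stdGaussian (EuclideanSpace ℝ (Fin n))))
    - ‖proj C θ - θ‖ ^ 2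

/-- The monotone cone `u_1 ≤ ⋯ ≤ u_n`. -/
def monotoneCone (n : ℕ) : Set (EuclideanSpace ℝ (Fin n)) :=
  {u | ∀ i j : Fin n, i ≤ j → u i ≤ u j}

/-- The block monotone cone of a partition of the index set into consecutive blocks. Such a
partition, with its blocks listed in increasing order, is a `Composition n`: the `j`-th block has
`c.blocksFun j ≥ 1` elements and is the range of the increasing map `c.embedding j`. -/
def blockMonotoneCone {n : ℕ} (c : Composition n) : Set (EuclideanSpace ℝ (Fin n)) :=
  {u | u ∈ monotoneCone n ∧
    ∀ (j : Fin c.length) (a b : Fin (c.blocksFun j)), u (c.embedding j a) = u (c.embedding j b)}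

/-- The blocks `J_1, …, J_K` of `J` are the constant pieces of `v`, with values
`μ_1 < ⋯ < μ_K`. -/
def IsConstantPieces {n : ℕ} (v : EuclideanSpace ℝ (Fin n)) (J : Composition n)
    (μ : Fin J.length → ℝ) : Prop :=
  StrictMono μ ∧ ∀ (k : Fin J.length) (a : Fin (J.blocksFun k)), v (J.embedding k a) = μ k

/-- `c` refines `d`: every block of `c` is contained in a block of `d`. -/
def Refines {m : ℕ} (c d : Composition m) : Prop :=
  ∀ j : Fin c.length, ∃ l : Fin d.length,
    Set.range (c.embedding j) ⊆ Set.range (d.embedding l)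

/-- Every block of the partition `I` has the property that the mean of `x` on it is `μ`. -/
def HasBlockMeans {m : ℕ} (x : Fin m → ℝ) (μ : ℝ) (I : Composition m) : Prop :=
  ∀ j : Fin I.length,
    1 / (I.blocksFun j : ℝ) * ∑ a : Fin (I.blocksFun j), x (I.embedding j a) = μ

/-- `I` is the finest partition into blocks on each of which `x` has mean `μ`: it is such a
partition, and it refines every such partition. -/
def IsFinestWithMean {m : ℕ} (x : Fin m → ℝ) (μ : ℝ) (I : Composition m) : Prop :=
  HasBlockMeans x μ I ∧ ∀ I' : Composition m, HasBlockMeans x μ I' → Refines I I'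

end

end Isotonic

open Isotonic

namespace Isotonic

/-! ### Compositions and their blocks -/

/-! Let `p` be the projection of `θ` onto the monotone cone. For each fixed `z` and all small `σ >
0` the projection of `θ + σ • z` is exactly `p + σ • u`, where `u = blockProj J I z` glues together
the projections of the pieces of `z` onto the block monotone cones (`eventually_proj_add_smul`).

This is checked by the variational inequality. The candidate is monotone because `p` jumps strictly
between the `J k` while `u` is monotone inside each. Against monotone test vectors on `J k`,
summation by parts reduces the inequality to the signs of tail sums of `θ - p + σ • (z - u)`. Tail
sums of `θ - p` are nonpositive. A negative one absorbs the perturbation for small `σ`. A vanishing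
one cannot start inside a block of the finest partition, so the indicator of that tail lies in the
block cone and the tail sum of `z - u` is nonpositive (`eventually_sum_mul_nonpos`). Moreover `u` is
orthogonal to `θ - p` (zero block sums) and to `z - u` (cone projection).

Nonexpansiveness dominates the scaled misspecified loss by `‖z‖ ^ 2`, so its limit is `E ‖u‖ ^ 2`,
which splits into statistical dimensions since coordinate restrictions of a standard Gaussian are
standard Gaussian. The excess risk adds a cross term that is of order `σ ^ 2` by `inner_proj_bounds`
and eventually zero pointwise. -/

theorem index_mono {n : ℕ} (c : Composition n) : Monotone c.index := by
  intro i j hij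
  by_contra! h
  have h1 : c.sizeUpTo ((c.index j : ℕ) + 1) ≤ c.sizeUpTo (c.index i) := c.monotone_sizeUpTo h
  have h2 := c.lt_sizeUpTo_index_succ j
  have h3 := c.sizeUpTo_index_le i
  have h4 : (i : ℕ) ≤ j := hij
  simp only [Fin.val_succ] at h2
  omega

theorem mem_boundaries_iff {n : ℕ} (c : Composition n) (b : Fin (n + 1)) :
    b ∈ c.boundaries ↔ ∃ l ≤ c.length, c.sizeUpTo l = b := by
  simp only [Composition.boundaries, Finset.mem_map, Finset.mem_univ, true_and]
  constructor
  · rintro ⟨l, rfl⟩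
    exact ⟨l, Nat.lt_succ_iff.mp l.2, rfl⟩
  · rintro ⟨l, hl, h⟩
    exact ⟨⟨l, Nat.lt_succ_iff.mpr hl⟩, Fin.ext h⟩

theorem index_eq_iff_forall_boundaries {n : ℕ} (c : Composition n) {i j : Fin n} (hij : i ≤ j) :
    c.index i = c.index j ↔ ∀ b ∈ c.boundaries, ¬ ((i : ℕ) < b ∧ (b : ℕ) ≤ j) := by
  constructor
  · rintro h b hb ⟨h1, h2⟩
    obtain ⟨l, -, hl⟩ := (mem_boundaries_iff c b).1 hb
    have h3 := c.lt_sizeUpTo_index_succ j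
    have h4 := c.sizeUpTo_index_le i
    simp only [Fin.val_succ, ← h] at h3
    rcases lt_or_ge (c.index i : ℕ) l with h5 | h5
    · have := c.monotone_sizeUpTo (show (c.index i : ℕ) + 1 ≤ l from h5)
      omega
    · have := c.monotone_sizeUpTo h5
      omega
  · intro h
    by_contra hne
    have hlt : c.index i < c.index j := lt_of_le_of_ne (index_mono c hij) hne
    refine h ⟨c.sizeUpTo (c.index j), Nat.lt_succ_iff.mpr (c.sizeUpTo_le _)⟩
      ((mem_boundaries_iff c _).2 ⟨c.index j, (c.index j).2.le, rfl⟩) ⟨?_, c.sizeUpTo_index_le j⟩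
    exact (c.lt_sizeUpTo_index_succ i).trans_le (c.monotone_sizeUpTo hlt)

theorem composition_ext_of_boundaries {n : ℕ} {c d : Composition n}
    (h : c.boundaries = d.boundaries) : c = d := by
  apply (compositionEquiv n).injective
  exact CompositionAsSet.ext h

/-- A composition is determined by the relation of lying in the same block. -/
theorem composition_ext_of_index {n : ℕ} {c d : Composition n}
    (h : ∀ i j, c.index i = c.index j ↔ d.index i = d.index j) : c = d := by
  apply composition_ext_of_boundaries
  -- Boundaries are `0`, `n` and the positions where the block index changes between neighbours, so
  -- the same-block relation recovers them.
  have key : ∀ (e : Composition n) (b : Fin (n + 1)), b ∈ e.boundaries ↔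
      (b : ℕ) = 0 ∨ (b : ℕ) = n ∨ ∃ i j : Fin n, (i : ℕ) + 1 = j ∧ (j : ℕ) = b ∧
        e.index i ≠ e.index j := by
    intro e b
    constructor
    · intro hb
      by_cases h0 : (b : ℕ) = 0
      · exact Or.inl h0
      by_cases hn : (b : ℕ) = n
      · exact Or.inr (Or.inl hn)
      have := b.2
      refine Or.inr (Or.inr ⟨⟨b - 1, by omega⟩, ⟨b, by omega⟩, by simp; omega, rfl, ?_⟩)
      rw [Ne, index_eq_iff_forall_boundaries e (by simp [Fin.le_def])]
      push Not
      exact ⟨b, hb, show (b : ℕ) - 1 < b by omega, le_rfl⟩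
    · rintro (h | h | ⟨i, j, hij, hj, hne⟩)
      · exact (mem_boundaries_iff e b).2 ⟨0, Nat.zero_le _, by simp [h]⟩
      · exact (mem_boundaries_iff e b).2 ⟨e.length, le_rfl, by simp [h]⟩
      · rw [Ne, index_eq_iff_forall_boundaries e (by rw [Fin.le_def]; omega)] at hne
        push Not at hne
        obtain ⟨b', hb', h1, h2⟩ := hne
        have : b' = b := Fin.ext (by omega)
        exact this ▸ hb'
  ext b
  rw [key, key]
  simp only [Ne, h]

/-- Every monotone function has a composition whose blocks are its level sets. -/
theorem exists_composition_index_eq_iff {n : ℕ} {α : Type*} [PartialOrder α] {f : Fin n → α}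
    (hf : Monotone f) : ∃ c : Composition n, ∀ i j, c.index i = c.index j ↔ f i = f j := by
  classical
  let S : CompositionAsSet n :=
    { boundaries := Finset.univ.filter fun b : Fin (n + 1) => (b : ℕ) = 0 ∨ (b : ℕ) = n ∨
        ∃ i j : Fin n, (i : ℕ) + 1 = j ∧ (j : ℕ) = b ∧ f i ≠ f j
      zero_mem := by simp
      getLast_mem := by simp }
  have hS : S.toComposition.boundaries = S.boundaries := S.toComposition_boundaries
  have key : ∀ i j : Fin n, i ≤ j →
      (S.toComposition.index i = S.toComposition.index j ↔ f i = f j) := by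
    intro i j hij
    rw [index_eq_iff_forall_boundaries _ hij, hS]
    simp only [S, Finset.mem_filter, Finset.mem_univ, true_and]
    constructor
    · intro h
      -- Walk from `i` to `j` one position at a time: a change of `f` would create a boundary in
      -- between.
      have step : ∀ d : ℕ, ∀ l : Fin n, (l : ℕ) = i + d → l ≤ j → f i = f l := by
        intro d
        induction d with
        | zero => exact fun l hl _ => congrArg f (Fin.ext (by simpa using hl.symm))
        | succ d ih =>
          intro l hl hlj
          have hlj' : (l : ℕ) ≤ j := hlj
          have := l.2
          have h1 := ih ⟨i + d, by omega⟩ rfl (by rw [Fin.le_def]; simp; omega)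
          rw [h1]
          by_contra hne
          exact h ⟨l, by omega⟩ (Or.inr (Or.inr ⟨⟨i + d, by omega⟩, l, by simp; omega, rfl, hne⟩))
            ⟨by simp; omega, hlj'⟩
      have hij' : (i : ℕ) ≤ j := hij
      exact step (j - i) j (by omega) le_rfl
    · rintro h b hb ⟨h1, h2⟩
      rcases hb with hb | hb | ⟨i', j', hij', hj', hne⟩
      · omega
      · have := j.2; omega
      · have e1 : f i ≤ f i' := hf (by rw [Fin.le_def]; omega)
        have e2 : f i' ≤ f j' := hf (by rw [Fin.le_def]; omega)
        have e3 : f j' ≤ f j := hf (by rw [Fin.le_def]; omega)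
        exact hne (le_antisymm e2 (e3.trans (h ▸ e1)))
  refine ⟨S.toComposition, fun i j => ?_⟩
  rcases le_total i j with hij | hij
  · exact key i j hij
  · rw [eq_comm, key j i hij, eq_comm]

theorem exists_embedding_eq {n : ℕ} (c : Composition n) (i : Fin n) :
    ∃ a, c.embedding (c.index i) a = i :=
  ⟨c.invEmbedding i, c.embedding_comp_inv i⟩

theorem sum_embedding {n : ℕ} {M : Type*} [AddCommMonoid M] (c : Composition n) (g : Fin n → M)
    (k : Fin c.length) :
    ∑ a, g (c.embedding k a) = ∑ i with c.index i = k, g i := by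
  classical
  refine Finset.sum_bij (fun a _ => c.embedding k a) (by simp)
    (fun a _ b _ h => (c.embedding k).injective h) ?_ (fun _ _ => rfl)
  intro i hi
  obtain ⟨a, ha⟩ := exists_embedding_eq c i
  obtain rfl : c.index i = k := by simpa using hi
  exact ⟨a, Finset.mem_univ _, ha⟩

theorem refines_iff {m : ℕ} {c d : Composition m} :
    Refines c d ↔ ∀ i j, c.index i = c.index j → d.index i = d.index j := by
  constructor
  · intro h i j hij
    obtain ⟨l, hl⟩ := h (c.index i)
    have h1 := hl (c.mem_range_embedding i)
    have h2 := hl (hij ▸ c.mem_range_embedding j)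
    rw [d.mem_range_embedding_iff'] at h1 h2
    exact h1.symm.trans h2
  · intro h j
    have hj := c.one_le_blocksFun j
    refine ⟨d.index (c.embedding j ⟨0, hj⟩), ?_⟩
    rintro _ ⟨a, rfl⟩
    rw [d.mem_range_embedding_iff']
    exact h _ _ (by simp)

/-! ### Block means, tail sums and the finest partition -/

theorem hasBlockMeans_iff {m : ℕ} {x : Fin m → ℝ} {μ : ℝ} {I : Composition m} :
    HasBlockMeans x μ I ↔ ∀ j, ∑ i with I.index i = j, (x i - μ) = 0 := by
  refine forall_congr' fun j => ?_
  have hpos : (0 : ℝ) < I.blocksFun j := by exact_mod_cast I.one_le_blocksFun j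
  rw [← sum_embedding I (fun i => x i - μ) j, Finset.sum_sub_distrib]
  simp only [Finset.sum_const, Finset.card_univ, Fintype.card_fin, nsmul_eq_mul]
  rw [one_div, inv_mul_eq_iff_eq_mul₀ hpos.ne', sub_eq_zero]

theorem sum_filter_le_index {m : ℕ} {g : Fin m → ℝ} {I : Composition m}
    (h : ∀ j, ∑ i with I.index i = j, g i = 0) (l : Fin I.length) :
    ∑ i with l ≤ I.index i, g i = 0 := by
  classical
  rw [← Finset.sum_fiberwise_of_maps_to (t := Finset.univ) (g := I.index) (by simp)]
  refine Finset.sum_eq_zero fun j _ => ?_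
  rw [Finset.filter_filter]
  by_cases hj : l ≤ j
  · rw [← h j]
    refine Finset.sum_congr (Finset.filter_congr fun i _ => ?_) fun _ _ => rfl
    exact ⟨fun h => h.2, fun h => ⟨h ▸ hj, h⟩⟩
  · rw [Finset.filter_false_of_mem, Finset.sum_empty]
    rintro i - ⟨h1, rfl⟩
    exact hj h1

/-- A partition with mean `μ` on every block whose boundaries are all the points where the
centred tail sums vanish. -/
theorem exists_isFinestWithMean {m : ℕ} {x : Fin m → ℝ} {μ : ℝ} (h0 : ∑ i, (x i - μ) = 0) :
    ∃ I : Composition m, IsFinestWithMean x μ I := by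
  classical
  set Z : Finset (Fin m) := Finset.univ.filter fun a => ∑ i with a ≤ i, (x i - μ) = 0 with hZ
  -- `f` counts the zeros of the tail sum up to `i`; its level sets are the intervals cut out by
  -- these zeros.
  set f : Fin m → ℕ := fun i => (Z.filter (· ≤ i)).card with hf
  have hmono : Monotone f := fun i j hij =>
    Finset.card_le_card (Finset.monotone_filter_right _ fun a _ ha => le_trans ha hij)
  have hstrict : ∀ {i j b}, b ∈ Z → i < b → b ≤ j → f i < f j := by
    intro i j b hb h1 h2
    refine Finset.card_lt_card ⟨Finset.monotone_filter_right _ fun a _ ha =>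
      le_trans ha (h1.le.trans h2), fun hsub => ?_⟩
    have := hsub (Finset.mem_filter.2 ⟨hb, h2⟩)
    exact absurd (Finset.mem_filter.1 this).2 (not_le.2 h1)
  -- An upper level set of `f`, if nonempty, starts at some `b`; either `b = 0` or `b` is a zero,
  -- since otherwise `f` would agree at `b - 1` and `b`.
  have htail : ∀ l : ℕ, ∑ i with l ≤ f i, (x i - μ) = 0 := by
    intro l
    rcases (Finset.univ.filter fun i => l ≤ f i).eq_empty_or_nonempty with he | hne
    · rw [he, Finset.sum_empty]
    · obtain ⟨b, hb, hmin⟩ := Finset.exists_min_image _ id hne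
      have hset : (Finset.univ.filter fun i => l ≤ f i) = Finset.univ.filter fun i => b ≤ i := by
        ext i
        simp only [Finset.mem_filter, Finset.mem_univ, true_and] at hb hmin ⊢
        exact ⟨fun h => hmin i h, fun h => hb.trans (hmono h)⟩
      rw [hset]
      simp only [Finset.mem_filter, Finset.mem_univ, true_and, id] at hb hmin
      by_contra hbZ
      have hb0 : (b : ℕ) ≠ 0 := by
        intro hb0
        apply hbZ
        rw [Finset.filter_true_of_mem fun i _ => by rw [Fin.le_def]; omega]
        exact h0
      have hlt := b.2
      have heq : f ⟨b - 1, by omega⟩ = f b := by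
        refine congrArg Finset.card (Finset.filter_congr fun a ha => ?_)
        have : a ≠ b := by
          rintro rfl
          exact hbZ (Finset.mem_filter.1 ha).2
        rw [Ne, Fin.ext_iff] at this
        simp only [Fin.le_def]
        omega
      have := hmin ⟨b - 1, by omega⟩ (heq ▸ hb)
      simp only [Fin.le_def] at this
      omega
  obtain ⟨I, hI⟩ := exists_composition_index_eq_iff hmono
  refine ⟨I, hasBlockMeans_iff.2 fun j => ?_, fun I' hI' => refines_iff.2 ?_⟩
  · have hj := I.one_le_blocksFun j
    set i₀ := I.embedding j ⟨0, hj⟩ with hi₀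
    -- A block is the difference of two successive upper level sets, both of sum zero.
    have hset : (Finset.univ.filter fun i => f i₀ ≤ f i) =
        (Finset.univ.filter fun i => I.index i = j) ∪
          Finset.univ.filter fun i => f i₀ + 1 ≤ f i := by
      ext i
      have : I.index i = j ↔ f i = f i₀ := by rw [← hI, hi₀, Composition.index_embedding]
      simp only [Finset.mem_filter, Finset.mem_univ, true_and, Finset.mem_union, this]
      omega
    have hdisj : Disjoint (Finset.univ.filter fun i => I.index i = j)
        (Finset.univ.filter fun i => f i₀ + 1 ≤ f i) := by
      rw [Finset.disjoint_filter]
      intro i _ h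
      have : f i = f i₀ := by rw [← hI, hi₀, Composition.index_embedding, h]
      omega
    have h1 := htail (f i₀)
    rw [hset, Finset.sum_union hdisj, htail, add_zero] at h1
    exact h1
  · have key : ∀ i j : Fin m, i ≤ j → I.index i = I.index j → I'.index i = I'.index j := by
      intro i j hij hIij
      by_contra hne
      have hlt : I'.index i < I'.index j := lt_of_le_of_ne (index_mono I' hij) hne
      have hsum := sum_filter_le_index (hasBlockMeans_iff.1 hI') (I'.index j)
      obtain ⟨b, hb, hmin⟩ := Finset.exists_min_image
        (Finset.univ.filter fun i => I'.index j ≤ I'.index i) id ⟨j, by simp⟩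
      simp only [Finset.mem_filter, Finset.mem_univ, true_and, id] at hb hmin
      have hbZ : b ∈ Z := by
        rw [hZ, Finset.mem_filter]
        refine ⟨Finset.mem_univ _, ?_⟩
        rw [← hsum]
        refine Finset.sum_congr (Finset.filter_congr fun a _ => ?_) fun _ _ => rfl
        exact ⟨fun h => hb.trans (index_mono I' h), fun h => hmin a h⟩
      have hib : i < b := by
        by_contra! h
        exact absurd (hb.trans (index_mono I' h)) (not_le.2 hlt)
      have := hstrict hbZ hib (hmin j le_rfl)
      exact this.ne ((hI i j).1 hIij)
    intro i j hij
    rcases le_total i j with h | h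
    · exact key i j h hij
    · exact (key j i h hij.symm).symm

theorem IsFinestWithMean.unique {m : ℕ} {x : Fin m → ℝ} {μ : ℝ} {I I' : Composition m}
    (h : IsFinestWithMean x μ I) (h' : IsFinestWithMean x μ I') : I = I' :=
  composition_ext_of_index fun i j =>
    ⟨refines_iff.1 (h.2 I' h'.1) i j, refines_iff.1 (h'.2 I h.1) i j⟩

/-- The blocks of the finest partition do not cross a point where the centred tail sum
vanishes. -/
theorem IsFinestWithMean.le_iff_le {m : ℕ} {x : Fin m → ℝ} {μ : ℝ} {I : Composition m}
    (h : IsFinestWithMean x μ I) {a : Fin m} (h0 : ∑ i, (x i - μ) = 0)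
    (ha : ∑ i with a ≤ i, (x i - μ) = 0) {i j : Fin m} (hij : I.index i = I.index j) :
    a ≤ i ↔ a ≤ j := by
  classical
  -- Compare `I` with the partition that cuts only at `a`; it is admissible because the total and
  -- the tail at `a` both vanish.
  obtain ⟨c, hc⟩ := exists_composition_index_eq_iff (f := fun i : Fin m => a ≤ i)
    (fun i j hij h => le_trans h hij)
  simp only [eq_iff_iff] at hc
  refine (hc i j).1 (refines_iff.1 (h.2 c (hasBlockMeans_iff.2 fun k => ?_)) i j hij)
  set b := c.embedding k ⟨0, c.one_le_blocksFun k⟩ with hb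
  have hk : ∀ l, c.index l = k ↔ (a ≤ l ↔ a ≤ b) := fun l => by
    rw [← hc, hb, Composition.index_embedding]
  simp only [hk]
  by_cases hab : a ≤ b
  · simpa only [hab, iff_true] using ha
  · simp only [hab, iff_false]
    rw [← Finset.sum_filter_add_sum_filter_not _ (fun i => a ≤ i), ha, zero_add] at h0
    exact h0

theorem IsConstantPieces.index_eq_iff {n : ℕ} {v : EuclideanSpace ℝ (Fin n)} {J : Composition n}
    {μ : Fin J.length → ℝ} (h : IsConstantPieces v J μ) (i j : Fin n) :
    J.index i = J.index j ↔ v i = v j := by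
  have key : ∀ i, v i = μ (J.index i) := fun i => by
    conv_lhs => rw [← J.embedding_comp_inv i]
    exact h.2 _ _
  rw [key, key, h.1.injective.eq_iff]

theorem existsUnique_isConstantPieces {n : ℕ} {v : EuclideanSpace ℝ (Fin n)}
    (hv : v ∈ monotoneCone n) :
    ∃! J : Composition n, ∃ μ : Fin J.length → ℝ, IsConstantPieces v J μ := by
  obtain ⟨J, hJ⟩ := exists_composition_index_eq_iff (f := fun i => v i) fun i j hij => hv i j hij
  refine ⟨J, ⟨fun k => v (J.embedding k ⟨0, J.one_le_blocksFun k⟩), fun k l hkl => ?_,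
    fun k a => (hJ _ _).1 (by simp)⟩, ?_⟩
  · have hle : J.embedding k ⟨0, J.one_le_blocksFun k⟩ ≤
        J.embedding l ⟨0, J.one_le_blocksFun l⟩ := by
      by_contra! h
      have := index_mono J h.le
      simp only [Composition.index_embedding] at this
      exact absurd hkl (not_lt.2 this)
    refine lt_of_le_of_ne (hv _ _ hle) fun h => hkl.ne ?_
    simpa using (hJ _ _).2 h
  · rintro J' ⟨μ, h⟩
    exact composition_ext_of_index fun i j => by rw [h.index_eq_iff, hJ]

/-! ### Euclidean projections -/

theorem inner_sub_proj_le_zero {n : ℕ} {C : Set (EuclideanSpace ℝ (Fin n))} (hne : C.Nonempty)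
    (hcl : IsClosed C) (hconv : Convex ℝ C) (x : EuclideanSpace ℝ (Fin n))
    {c : EuclideanSpace ℝ (Fin n)} (hc : c ∈ C) : inner ℝ (x - proj C x) (c - proj C x) ≤ 0 := by
  obtain ⟨hp, hmin⟩ := proj_mem_isMinOn hne hcl x
  refine (norm_eq_iInf_iff_real_inner_le_zero hconv hp).1 ?_ c hc
  have : Nonempty C := ⟨⟨_, hp⟩⟩
  refine le_antisymm (le_ciInf fun w => ?_)
    (ciInf_le ⟨0, by rintro _ ⟨w, rfl⟩; exact norm_nonneg _⟩ (⟨_, hp⟩ : C))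
  exact le_of_sq_le_sq (hmin w.2) (norm_nonneg _)

theorem proj_eq_of_inner_le_zero {n : ℕ} {C : Set (EuclideanSpace ℝ (Fin n))}
    (hcl : IsClosed C) (hconv : Convex ℝ C) {x p : EuclideanSpace ℝ (Fin n)} (hp : p ∈ C)
    (h : ∀ c ∈ C, inner ℝ (x - p) (c - p) ≤ 0) : proj C x = p := by
  refine (eq_proj hcl hconv hp fun z hz => ?_).symm
  have h1 := norm_sub_sq_real (x - p) (z - p)
  rw [sub_sub_sub_cancel_right] at h1
  have h2 := h z hz
  have h3 := sq_nonneg ‖z - p‖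
  show ‖x - p‖ ^ 2 ≤ ‖x - z‖ ^ 2
  linarith

/-- Add the variational inequalities at `x` and `y`, each tested at the other projection, and apply
Cauchy–Schwarz. -/
theorem norm_proj_sub_proj_le {n : ℕ} {C : Set (EuclideanSpace ℝ (Fin n))} (hne : C.Nonempty)
    (hcl : IsClosed C) (hconv : Convex ℝ C) (x y : EuclideanSpace ℝ (Fin n)) :
    ‖proj C x - proj C y‖ ≤ ‖x - y‖ := by
  have h1 := inner_sub_proj_le_zero hne hcl hconv x (proj_mem_isMinOn hne hcl y).1
  have h2 := inner_sub_proj_le_zero hne hcl hconv y (proj_mem_isMinOn hne hcl x).1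
  generalize proj C x = p at *
  generalize proj C y = q at *
  have h3 : ‖p - q‖ ^ 2 = inner ℝ (x - y) (p - q) + inner ℝ (x - p) (q - p) +
      inner ℝ (y - q) (p - q) := by
    rw [← real_inner_self_eq_norm_sq, ← neg_sub p q, inner_neg_right]
    simp only [inner_sub_left]
    ring
  have h4 := real_inner_le_norm (x - y) (p - q)
  by_contra! h5
  nlinarith [norm_nonneg (x - y)]

theorem continuous_proj {n : ℕ} {C : Set (EuclideanSpace ℝ (Fin n))} (hne : C.Nonempty)
    (hcl : IsClosed C) (hconv : Convex ℝ C) : Continuous (proj C) :=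
  (LipschitzWith.of_dist_le_mul (K := 1) fun x y => by
    simpa [dist_eq_norm] using norm_proj_sub_proj_le hne hcl hconv x y).continuous

theorem inner_sub_proj_le_zero_of_add {n : ℕ} {C : Set (EuclideanSpace ℝ (Fin n))}
    (hne : C.Nonempty) (hcl : IsClosed C) (hconv : Convex ℝ C)
    (hadd : ∀ u ∈ C, ∀ v ∈ C, u + v ∈ C) (x : EuclideanSpace ℝ (Fin n))
    {c : EuclideanSpace ℝ (Fin n)} (hc : c ∈ C) : inner ℝ (x - proj C x) c ≤ 0 := by
  have := inner_sub_proj_le_zero hne hcl hconv x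
    (hadd _ (proj_mem_isMinOn hne hcl x).1 _ hc)
  rwa [add_sub_cancel_left] at this

theorem inner_sub_proj_self {n : ℕ} {C : Set (EuclideanSpace ℝ (Fin n))}
    (h0 : 0 ∈ C) (hcl : IsClosed C) (hconv : Convex ℝ C)
    (hadd : ∀ u ∈ C, ∀ v ∈ C, u + v ∈ C) (x : EuclideanSpace ℝ (Fin n)) :
    inner ℝ (x - proj C x) (proj C x) = 0 := by
  have h1 := inner_sub_proj_le_zero ⟨0, h0⟩ hcl hconv x h0
  have h2 := inner_sub_proj_le_zero_of_add ⟨0, h0⟩ hcl hconv hadd x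
    (proj_mem_isMinOn ⟨0, h0⟩ hcl x).1
  rw [zero_sub, inner_neg_right] at h1
  linarith

/-! ### The cones -/

theorem isClosed_monotoneCone (n : ℕ) : IsClosed (monotoneCone n) := by
  simp only [monotoneCone, Set.ofPred_forall]
  exact isClosed_iInter fun i => isClosed_iInter fun j => isClosed_iInter fun _ =>
    isClosed_le (by fun_prop) (by fun_prop)

theorem zero_mem_monotoneCone (n : ℕ) : 0 ∈ monotoneCone n := fun _ _ _ => le_rfl

theorem convex_monotoneCone (n : ℕ) : Convex ℝ (monotoneCone n) := by
  intro u hu v hv a b ha hb _ i j hij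
  simp only [PiLp.add_apply, PiLp.smul_apply, smul_eq_mul]
  have := mul_le_mul_of_nonneg_left (hu i j hij) ha
  have := mul_le_mul_of_nonneg_left (hv i j hij) hb
  linarith

theorem mem_blockMonotoneCone_iff {n : ℕ} {c : Composition n} {u : EuclideanSpace ℝ (Fin n)} :
    u ∈ blockMonotoneCone c ↔
      u ∈ monotoneCone n ∧ ∀ i j, c.index i = c.index j → u i = u j := by
  refine and_congr_right fun _ => ⟨fun h i j hij => ?_, fun h j a b => h _ _ (by simp)⟩
  obtain ⟨a, ha⟩ := exists_embedding_eq c i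
  obtain ⟨b, hb⟩ := exists_embedding_eq c j
  rw [← ha, ← hb]
  generalize c.index i = k at *
  subst hij
  exact h _ _ _

theorem isClosed_blockMonotoneCone {n : ℕ} (c : Composition n) :
    IsClosed (blockMonotoneCone c) := by
  have h : IsClosed {u : EuclideanSpace ℝ (Fin n) | ∀ (j : Fin c.length)
      (a b : Fin (c.blocksFun j)), u (c.embedding j a) = u (c.embedding j b)} := by
    simp only [Set.ofPred_forall]
    exact isClosed_iInter fun j => isClosed_iInter fun a => isClosed_iInter fun b =>
      isClosed_eq (by fun_prop) (by fun_prop)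
  exact (isClosed_monotoneCone n).inter h

theorem zero_mem_blockMonotoneCone {n : ℕ} (c : Composition n) : 0 ∈ blockMonotoneCone c :=
  ⟨zero_mem_monotoneCone n, fun _ _ _ => rfl⟩

theorem convex_blockMonotoneCone {n : ℕ} (c : Composition n) :
    Convex ℝ (blockMonotoneCone c) := fun u hu v hv a b ha hb hab =>
  ⟨convex_monotoneCone n hu.1 hv.1 ha hb hab, fun j i l => by
    simp only [PiLp.add_apply, PiLp.smul_apply, hu.2 j i l, hv.2 j i l]⟩

theorem add_mem_blockMonotoneCone {n : ℕ} (c : Composition n) :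
    ∀ u ∈ blockMonotoneCone c, ∀ v ∈ blockMonotoneCone c, u + v ∈ blockMonotoneCone c :=
  fun _ hu _ hv => ⟨fun i j hij => add_le_add (hu.1 i j hij) (hv.1 i j hij), fun j i l => by
    simp only [PiLp.add_apply, hu.2 j i l, hv.2 j i l]⟩

/-- Summation by parts against a monotone sequence. -/
theorem sum_mul_le_of_tail_nonpos {m : ℕ} {s v : Fin (m + 1) → ℝ} (hv : Monotone v)
    (hs : ∀ a, a ≠ 0 → ∑ i with a ≤ i, s i ≤ 0) : ∑ i, s i * v i ≤ v 0 * ∑ i, s i := by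
  induction m with
  | zero => simp [mul_comm]
  | succ m ih =>
    have htail : ∀ a : Fin (m + 1), ∑ i with a ≤ i, s i.succ = ∑ i with a.succ ≤ i, s i := by
      intro a
      rw [Finset.sum_filter, Finset.sum_filter, Fin.sum_univ_succ (n := m + 1)]
      simp [Fin.succ_ne_zero]
    have h1 := ih (s := fun i => s i.succ) (v := fun i => v i.succ)
      (fun i j hij => hv (Fin.succ_le_succ_iff.2 hij))
      (fun a _ => by rw [htail]; exact hs _ (Fin.succ_ne_zero a))
    have h2 : ∑ i : Fin (m + 1), s i.succ ≤ 0 := by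
      have := htail 0
      simp only [Fin.zero_le, Finset.filter_true] at this
      rw [this]
      exact hs _ (Fin.succ_ne_zero 0)
    -- The remaining tail sum is nonpositive, so lowering its coefficient from `v 1` to `v 0` only
    -- weakens the bound.
    have h3 : v 0 ≤ v (Fin.succ 0) := hv (Fin.zero_le _)
    rw [Fin.sum_univ_succ, Fin.sum_univ_succ (f := s)]
    nlinarith

theorem sum_mul_nonpos_of_tail_nonpos {m : ℕ} {s v : Fin m → ℝ} (hv : Monotone v)
    (h0 : ∑ i, s i = 0) (hs : ∀ a, ∑ i with a ≤ i, s i ≤ 0) : ∑ i, s i * v i ≤ 0 := by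
  cases m with
  | zero => simp
  | succ m => simpa [h0] using sum_mul_le_of_tail_nonpos hv fun a _ => hs a

/-! ### A single block -/

/-- Constant vectors of either sign lie in the cone. -/
theorem sum_sub_proj_blockMonotoneCone {m : ℕ} (I : Composition m)
    (z : EuclideanSpace ℝ (Fin m)) : ∑ i, (z i - proj (blockMonotoneCone I) z i) = 0 := by
  have key : ∀ t : ℝ, t * ∑ i, (z i - proj (blockMonotoneCone I) z i) ≤ 0 := by
    intro t
    have := inner_sub_proj_le_zero_of_add ⟨0, zero_mem_blockMonotoneCone I⟩
      (isClosed_blockMonotoneCone I) (convex_blockMonotoneCone I) (add_mem_blockMonotoneCone I) z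
      (c := WithLp.toLp 2 fun _ => t) ⟨fun _ _ _ => le_rfl, fun _ _ _ => rfl⟩
    rw [PiLp.inner_apply] at this
    rw [Finset.mul_sum]
    simpa using this
  linarith [key 1, key (-1)]

theorem sum_mul_eq_zero_of_mem_blockMonotoneCone {m : ℕ} {x : Fin m → ℝ} {μ : ℝ}
    {I : Composition m} (hI : HasBlockMeans x μ I) {u : EuclideanSpace ℝ (Fin m)}
    (hu : u ∈ blockMonotoneCone I) : ∑ i, (x i - μ) * u i = 0 := by
  rw [← Finset.sum_fiberwise_of_maps_to (t := Finset.univ) (g := I.index) (by simp)]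
  refine Finset.sum_eq_zero fun j _ => ?_
  have hj := I.one_le_blocksFun j
  rw [Finset.sum_congr rfl (g := fun i => (x i - μ) * u (I.embedding j ⟨0, hj⟩)),
    ← Finset.sum_mul, hasBlockMeans_iff.1 hI j, zero_mul]
  intro i hi
  rw [(mem_blockMonotoneCone_iff.1 hu).2 i (I.embedding j ⟨0, hj⟩) (by simpa using hi)]

/-- The core of the argument, and the place where finestness enters. There are finitely many tails:
negative ones stay negative for small `σ`, vanishing ones are handled by an indicator in the cone.
-/
theorem eventually_sum_mul_nonpos {m : ℕ} {x : Fin m → ℝ} {μ : ℝ} {I : Composition m}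
    (hI : IsFinestWithMean x μ I) (h0 : ∑ i, (x i - μ) = 0)
    (htail : ∀ a, ∑ i with a ≤ i, (x i - μ) ≤ 0) (z : EuclideanSpace ℝ (Fin m)) :
    ∀ᶠ σ : ℝ in 𝓝[>] 0, ∀ v : Fin m → ℝ, Monotone v →
      ∑ i, (x i - μ + σ * (z i - proj (blockMonotoneCone I) z i)) * v i ≤ 0 := by
  have hev : ∀ᶠ σ : ℝ in 𝓝[>] 0, ∀ a : Fin m,
      ∑ i with a ≤ i, (x i - μ + σ * (z i - proj (blockMonotoneCone I) z i)) ≤ 0 := by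
    refine eventually_all.2 fun a => ?_
    simp only [Finset.sum_add_distrib, ← Finset.mul_sum]
    rcases (htail a).lt_or_eq with h | h
    · have ht : Tendsto (fun σ : ℝ => ∑ i with a ≤ i, (x i - μ) +
          σ * ∑ i with a ≤ i, (z i - proj (blockMonotoneCone I) z i)) (𝓝[>] 0)
          (𝓝 (∑ i with a ≤ i, (x i - μ) +
            0 * ∑ i with a ≤ i, (z i - proj (blockMonotoneCone I) z i))) := by
        refine Tendsto.mono_left (Continuous.tendsto ?_ 0) nhdsWithin_le_nhds
        fun_prop
      rw [zero_mul, add_zero] at ht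
      exact (ht.eventually_lt_const h).mono fun _ h => h.le
    -- The tail indicator is constant on the blocks of `I`, since none of them crosses a zero of the
    -- tail sum.
    · have hmem : (WithLp.toLp 2 fun i => if a ≤ i then (1 : ℝ) else 0) ∈ blockMonotoneCone I := by
        refine mem_blockMonotoneCone_iff.2 ⟨fun i j hij => ?_, fun i j hij => ?_⟩
        · by_cases hai : a ≤ i
          · simp [hai, hai.trans hij]
          · simp only [hai, if_false]
            split_ifs <;> norm_num
        · simp only [hI.le_iff_le h0 h hij]
      have hle := inner_sub_proj_le_zero_of_add ⟨0, zero_mem_blockMonotoneCone I⟩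
        (isClosed_blockMonotoneCone I) (convex_blockMonotoneCone I) (add_mem_blockMonotoneCone I)
        z hmem
      rw [PiLp.inner_apply] at hle
      have hle' : ∑ i with a ≤ i, (z i - proj (blockMonotoneCone I) z i) ≤ 0 := by
        rw [Finset.sum_filter]
        simpa using hle
      filter_upwards [self_mem_nhdsWithin] with σ hσ
      rw [h, zero_add]
      exact mul_nonpos_of_nonneg_of_nonpos (le_of_lt hσ) hle'
  filter_upwards [hev] with σ hσ v hv
  refine sum_mul_nonpos_of_tail_nonpos hv ?_ hσ
  rw [Finset.sum_add_distrib, ← Finset.mul_sum, h0, sum_sub_proj_blockMonotoneCone, mul_zero,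
    add_zero]

/-! ### Coordinate restriction of the standard Gaussian -/

/-- Restriction of a vector to the coordinates `e a`. -/
noncomputable def restrict {m n : ℕ} (e : Fin m → Fin n) (x : EuclideanSpace ℝ (Fin n)) :
    EuclideanSpace ℝ (Fin m) :=
  WithLp.toLp 2 fun a => x (e a)

theorem continuous_restrict {m n : ℕ} (e : Fin m → Fin n) : Continuous (restrict e) := by
  unfold restrict
  fun_prop

/-- Compare characteristic functions: pairing a restriction with `t` is pairing with the extension
of `t` by zero, which has the same norm. -/
theorem map_restrict_stdGaussian {m n : ℕ} {e : Fin m → Fin n} (he : Function.Injective e) :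
    (stdGaussian (EuclideanSpace ℝ (Fin n))).map (restrict e) =
      stdGaussian (EuclideanSpace ℝ (Fin m)) := by
  have hmeas : Measurable (restrict e) := (continuous_restrict e).measurable
  have : IsProbabilityMeasure ((stdGaussian (EuclideanSpace ℝ (Fin n))).map (restrict e)) :=
    Measure.isProbabilityMeasure_map hmeas.aemeasurable
  refine Measure.ext_of_charFun ?_
  ext t
  let S : EuclideanSpace ℝ (Fin n) := WithLp.toLp 2 (Function.extend e (fun a => t a) 0)
  have hS : ∀ i ∉ Set.range e, S i = 0 := fun i hi => by
    simp only [S]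
    rw [Function.extend_apply' _ _ _ (by simpa using hi)]
    rfl
  have hSe : ∀ a, S (e a) = t a := fun a => he.extend_apply _ _ a
  have hinner : ∀ x, inner ℝ (restrict e x) t = inner ℝ x S := fun x => by
    rw [PiLp.inner_apply, PiLp.inner_apply]
    exact Fintype.sum_of_injective e he _ _ (fun i hi => by simp [hS i hi])
      (fun a => by simp [hSe, restrict])
  have hnorm : ‖S‖ ^ 2 = ‖t‖ ^ 2 := by
    rw [EuclideanSpace.norm_sq_eq, EuclideanSpace.norm_sq_eq]
    exact (Fintype.sum_of_injective e he _ _ (fun i hi => by simp [hS i hi])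
      (fun a => by simp [hSe])).symm
  rw [charFun_apply, integral_map hmeas.aemeasurable (by fun_prop)]
  simp only [hinner]
  rw [← charFun_apply, charFun_stdGaussian, charFun_stdGaussian]
  norm_cast
  rw [hnorm]

theorem integrable_norm_sq_stdGaussian (n : ℕ) :
    Integrable (fun z : EuclideanSpace ℝ (Fin n) => ‖z‖ ^ 2)
      (stdGaussian (EuclideanSpace ℝ (Fin n))) :=
  (IsGaussian.memLp_two_id (μ := stdGaussian (EuclideanSpace ℝ (Fin n)))).integrable_norm_pow
    (by norm_num)

theorem integrable_norm_sq_proj_restrict {m n : ℕ} (e : Fin m ↪o Fin n) (c : Composition m) :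
    Integrable (fun z => ‖proj (blockMonotoneCone c) (restrict e z)‖ ^ 2)
      (stdGaussian (EuclideanSpace ℝ (Fin n))) := by
  have hc := continuous_proj ⟨0, zero_mem_blockMonotoneCone c⟩
    (isClosed_blockMonotoneCone c) (convex_blockMonotoneCone c)
  have h : Integrable (fun z => ‖proj (blockMonotoneCone c) z‖ ^ 2)
      ((stdGaussian (EuclideanSpace ℝ (Fin n))).map (restrict e)) := by
    rw [map_restrict_stdGaussian e.injective]
    refine (integrable_norm_sq_stdGaussian m).mono' (hc.norm.pow 2).aestronglyMeasurable
      (ae_of_all _ fun z => ?_)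
    rw [Real.norm_of_nonneg (by positivity)]
    have hp : proj (blockMonotoneCone c) 0 = 0 :=
      proj_eq_of_inner_le_zero (isClosed_blockMonotoneCone c) (convex_blockMonotoneCone c)
        (zero_mem_blockMonotoneCone c) (by simp)
    have := norm_proj_sub_proj_le ⟨0, zero_mem_blockMonotoneCone c⟩
      (isClosed_blockMonotoneCone c) (convex_blockMonotoneCone c) z 0
    rw [hp, sub_zero, sub_zero] at this
    gcongr
  exact h.comp_measurable (continuous_restrict e).measurable

theorem integral_norm_sq_proj_restrict {m n : ℕ} (e : Fin m ↪o Fin n) (c : Composition m) :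
    ∫ z, ‖proj (blockMonotoneCone c) (restrict e z)‖ ^ 2
      ∂(stdGaussian (EuclideanSpace ℝ (Fin n))) = statDim (blockMonotoneCone c) := by
  have hc := continuous_proj ⟨0, zero_mem_blockMonotoneCone c⟩
    (isClosed_blockMonotoneCone c) (convex_blockMonotoneCone c)
  rw [statDim, ← map_restrict_stdGaussian e.injective,
    integral_map (continuous_restrict e).measurable.aemeasurable (by fun_prop)]

/-! ### Low noise limits of the risks -/

/-- The lower bound is the variational inequality at `θ`; the upper one comes from that at `θ + w`,
Cauchy–Schwarz and nonexpansiveness. The quadratic bound allows the cross term of the excess risk to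
be divided by `σ ^ 2`. -/
theorem inner_proj_bounds {n : ℕ} {C : Set (EuclideanSpace ℝ (Fin n))} (hne : C.Nonempty)
    (hcl : IsClosed C) (hconv : Convex ℝ C) (θ w : EuclideanSpace ℝ (Fin n)) :
    0 ≤ inner ℝ (θ - proj C θ) (proj C θ - proj C (θ + w)) ∧
      inner ℝ (θ - proj C θ) (proj C θ - proj C (θ + w)) ≤ ‖w‖ ^ 2 := by
  have h1 := inner_sub_proj_le_zero hne hcl hconv θ (proj_mem_isMinOn hne hcl (θ + w)).1
  have h2 := inner_sub_proj_le_zero hne hcl hconv (θ + w) (proj_mem_isMinOn hne hcl θ).1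
  have h3 := norm_proj_sub_proj_le hne hcl hconv (θ + w) θ
  rw [add_sub_cancel_left] at h3
  generalize proj C (θ + w) = q at *
  generalize proj C θ = p at *
  have e1 : inner ℝ (θ - p) (q - p) = - inner ℝ (θ - p) (p - q) := by
    rw [← inner_neg_right, neg_sub]
  have e2 : inner ℝ (θ + w - q) (p - q) =
      inner ℝ (θ - p) (p - q) + inner ℝ w (p - q) + ‖p - q‖ ^ 2 := by
    rw [← real_inner_self_eq_norm_sq, ← inner_add_left, ← inner_add_left]
    congr 1
    abel
  have h4 : - inner ℝ w (p - q) ≤ ‖w‖ * ‖q - p‖ := by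
    rw [← inner_neg_right, neg_sub]
    exact real_inner_le_norm _ _
  have h5 : ‖w‖ * ‖q - p‖ ≤ ‖w‖ ^ 2 := by
    rw [sq]
    gcongr
  exact ⟨by linarith, by linarith [sq_nonneg ‖p - q‖]⟩

theorem tendsto_misspecifiedRisk {n : ℕ} {C : Set (EuclideanSpace ℝ (Fin n))} (hne : C.Nonempty)
    (hcl : IsClosed C) (hconv : Convex ℝ C) {θ : EuclideanSpace ℝ (Fin n)}
    {U : EuclideanSpace ℝ (Fin n) → EuclideanSpace ℝ (Fin n)}
    (hU : ∀ z, ∀ᶠ σ : ℝ in 𝓝[>] 0, proj C (θ + σ • z) = proj C θ + σ • U z) :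
    Tendsto (fun σ : ℝ => 1 / σ ^ 2 * misspecifiedRisk C θ σ) (𝓝[>] 0)
      (𝓝 (∫ z, ‖U z‖ ^ 2 ∂(stdGaussian (EuclideanSpace ℝ (Fin n))))) := by
  have hc := continuous_proj hne hcl hconv
  simp only [misspecifiedRisk, ← integral_const_mul]
  refine tendsto_integral_filter_of_dominated_convergence (fun z => ‖z‖ ^ 2) ?_ ?_
    (integrable_norm_sq_stdGaussian n) ?_
  · exact Eventually.of_forall fun σ => Continuous.aestronglyMeasurable (by fun_prop)
  · filter_upwards [self_mem_nhdsWithin] with σ hσ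
    have hσ : 0 < σ := hσ
    refine ae_of_all _ fun z => ?_
    have h := norm_proj_sub_proj_le hne hcl hconv (θ + σ • z) θ
    rw [add_sub_cancel_left, norm_smul, Real.norm_of_nonneg hσ.le] at h
    rw [Real.norm_of_nonneg (by positivity), one_div, inv_mul_le_iff₀ (by positivity), ← mul_pow]
    gcongr
  · refine ae_of_all _ fun z => tendsto_const_nhds.congr' ?_
    filter_upwards [self_mem_nhdsWithin, hU z] with σ hσ h
    have hσ : σ ≠ 0 := ne_of_gt hσ
    rw [h, add_sub_cancel_left, norm_smul, mul_pow, Real.norm_eq_abs, sq_abs]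
    field_simp

/-- Expand the square around `proj C θ`. -/
theorem excessRisk_eq {n : ℕ} {C : Set (EuclideanSpace ℝ (Fin n))} (hne : C.Nonempty)
    (hcl : IsClosed C) (hconv : Convex ℝ C) (θ : EuclideanSpace ℝ (Fin n)) (σ : ℝ) :
    excessRisk C θ σ = misspecifiedRisk C θ σ +
      ∫ z, 2 * inner ℝ (θ - proj C θ) (proj C θ - proj C (θ + σ • z))
        ∂(stdGaussian (EuclideanSpace ℝ (Fin n))) := by
  have hc := continuous_proj hne hcl hconv
  have hsq : Integrable (fun z : EuclideanSpace ℝ (Fin n) => ‖σ • z‖ ^ 2)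
      (stdGaussian (EuclideanSpace ℝ (Fin n))) := by
    simp only [norm_smul, mul_pow]
    exact (integrable_norm_sq_stdGaussian n).const_mul _
  have i1 : Integrable (fun z => ‖proj C (θ + σ • z) - proj C θ‖ ^ 2)
      (stdGaussian (EuclideanSpace ℝ (Fin n))) := by
    refine hsq.mono' (Continuous.aestronglyMeasurable (by fun_prop)) (ae_of_all _ fun z => ?_)
    have h := norm_proj_sub_proj_le hne hcl hconv (θ + σ • z) θ
    rw [add_sub_cancel_left] at h
    rw [Real.norm_of_nonneg (by positivity)]
    gcongr
  have i2 : Integrable (fun z => 2 * inner ℝ (θ - proj C θ) (proj C θ - proj C (θ + σ • z)))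
      (stdGaussian (EuclideanSpace ℝ (Fin n))) := by
    refine Integrable.const_mul ?_ 2
    refine hsq.mono' (Continuous.aestronglyMeasurable (by fun_prop)) (ae_of_all _ fun z => ?_)
    have h := inner_proj_bounds hne hcl hconv θ (σ • z)
    rw [Real.norm_of_nonneg h.1]
    exact h.2
  have hpt : ∀ z, ‖proj C (θ + σ • z) - θ‖ ^ 2 = ‖proj C (θ + σ • z) - proj C θ‖ ^ 2 +
      2 * inner ℝ (θ - proj C θ) (proj C θ - proj C (θ + σ • z)) + ‖proj C θ - θ‖ ^ 2 := by
    intro z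
    generalize proj C (θ + σ • z) = q
    generalize proj C θ = p
    have := norm_add_sq_real (q - p) (p - θ)
    rw [sub_add_sub_cancel] at this
    rw [this, real_inner_comm, ← neg_sub θ p, ← neg_sub p q, inner_neg_left, inner_neg_right,
      neg_neg]
  rw [excessRisk, misspecifiedRisk]
  simp only [hpt]
  have i12 : Integrable (fun z => ‖proj C (θ + σ • z) - proj C θ‖ ^ 2 +
      2 * inner ℝ (θ - proj C θ) (proj C θ - proj C (θ + σ • z)))
      (stdGaussian (EuclideanSpace ℝ (Fin n))) := i1.add i2
  rw [integral_add i12 (integrable_const _), integral_add i1 i2]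
  simp

theorem tendsto_excessRisk {n : ℕ} {C : Set (EuclideanSpace ℝ (Fin n))} (hne : C.Nonempty)
    (hcl : IsClosed C) (hconv : Convex ℝ C) {θ : EuclideanSpace ℝ (Fin n)}
    {U : EuclideanSpace ℝ (Fin n) → EuclideanSpace ℝ (Fin n)}
    (hU : ∀ z, ∀ᶠ σ : ℝ in 𝓝[>] 0, proj C (θ + σ • z) = proj C θ + σ • U z)
    (horth : ∀ z, inner ℝ (θ - proj C θ) (U z) = 0) :
    Tendsto (fun σ : ℝ => 1 / σ ^ 2 * excessRisk C θ σ) (𝓝[>] 0)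
      (𝓝 (∫ z, ‖U z‖ ^ 2 ∂(stdGaussian (EuclideanSpace ℝ (Fin n))))) := by
  have hc := continuous_proj hne hcl hconv
  simp only [excessRisk_eq hne hcl hconv, mul_add]
  rw [← add_zero (∫ z, ‖U z‖ ^ 2 ∂(stdGaussian (EuclideanSpace ℝ (Fin n))))]
  refine (tendsto_misspecifiedRisk hne hcl hconv hU).add ?_
  simp only [← integral_const_mul]
  rw [show 𝓝 (0 : ℝ) = 𝓝 (∫ _ : EuclideanSpace ℝ (Fin n), (0 : ℝ)
    ∂(stdGaussian (EuclideanSpace ℝ (Fin n)))) by rw [integral_zero]]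
  refine tendsto_integral_filter_of_dominated_convergence (fun z => 2 * ‖z‖ ^ 2) ?_ ?_
    ((integrable_norm_sq_stdGaussian n).const_mul 2) ?_
  · exact Eventually.of_forall fun σ => Continuous.aestronglyMeasurable (by fun_prop)
  · filter_upwards [self_mem_nhdsWithin] with σ hσ
    have hσ : 0 < σ := hσ
    refine ae_of_all _ fun z => ?_
    have h := inner_proj_bounds hne hcl hconv θ (σ • z)
    rw [norm_smul, Real.norm_of_nonneg hσ.le, mul_pow] at h
    rw [Real.norm_of_nonneg (mul_nonneg (by positivity) (mul_nonneg (by norm_num) h.1)), one_div,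
      inv_mul_le_iff₀ (by positivity)]
    linarith [h.2]
  · refine ae_of_all _ fun z => tendsto_const_nhds.congr' ?_
    filter_upwards [hU z] with σ h
    rw [h, sub_add_cancel_left, inner_neg_right, inner_smul_right, horth]
    simp

/-! ### The projection onto the monotone cone near a given point -/

theorem inner_eq_sum_embedding {n : ℕ} (J : Composition n) (x y : EuclideanSpace ℝ (Fin n)) :
    inner ℝ x y = ∑ k, ∑ a, x (J.embedding k a) * y (J.embedding k a) := by
  rw [PiLp.inner_apply, J.sum_sum_apply_embedding fun i => x i * y i]
  simp [mul_comm]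

/-- Strict inequalities of `p` survive small perturbations; only ties constrain `v`. -/
theorem eventually_add_smul_mem_monotoneCone {n : ℕ} {p v : EuclideanSpace ℝ (Fin n)}
    (hp : p ∈ monotoneCone n) (hv : ∀ i j, i ≤ j → p i = p j → v i ≤ v j) :
    ∀ᶠ σ : ℝ in 𝓝[>] 0, p + σ • v ∈ monotoneCone n := by
  refine eventually_all.2 fun i => eventually_all.2 fun j => ?_
  by_cases hij : i ≤ j
  swap
  · exact Eventually.of_forall fun _ h => absurd h hij
  simp only [PiLp.add_apply, PiLp.smul_apply, smul_eq_mul]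
  rcases (hp i j hij).lt_or_eq with h | h
  · have ht : ∀ l, Tendsto (fun σ : ℝ => p l + σ * v l) (𝓝[>] 0) (𝓝 (p l + 0 * v l)) := by
      intro l
      refine Tendsto.mono_left (Continuous.tendsto ?_ 0) nhdsWithin_le_nhds
      fun_prop
    have := (ht i).eventually_lt (ht j) (by simpa using h)
    exact this.mono fun _ h _ => h.le
  · filter_upwards [self_mem_nhdsWithin] with σ hσ _
    have := mul_le_mul_of_nonneg_left (hv i j hij h) (le_of_lt hσ)
    linarith

/-- Such `v` are feasible directions at the projection: test the variational inequality after a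
small step along `v`. -/
theorem inner_sub_proj_monotoneCone_nonpos {n : ℕ} {θ v : EuclideanSpace ℝ (Fin n)}
    (hv : ∀ i j, i ≤ j → proj (monotoneCone n) θ i = proj (monotoneCone n) θ j → v i ≤ v j) :
    inner ℝ (θ - proj (monotoneCone n) θ) v ≤ 0 := by
  have hne : (monotoneCone n).Nonempty := ⟨0, zero_mem_monotoneCone n⟩
  have hev := eventually_add_smul_mem_monotoneCone
    (proj_mem_isMinOn hne (isClosed_monotoneCone n) θ).1 hv
  obtain ⟨σ, h, hσ⟩ := (hev.and self_mem_nhdsWithin).exists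
  have := inner_sub_proj_le_zero hne (isClosed_monotoneCone n) (convex_monotoneCone n) θ h
  rw [add_sub_cancel_left, inner_smul_right] at this
  exact nonpos_of_mul_nonpos_right this hσ

theorem inner_sub_proj_eq_sum {n : ℕ} {θ : EuclideanSpace ℝ (Fin n)} {J : Composition n}
    {μ : Fin J.length → ℝ} (hJ : IsConstantPieces (proj (monotoneCone n) θ) J μ)
    (v : EuclideanSpace ℝ (Fin n)) :
    inner ℝ (θ - proj (monotoneCone n) θ) v =
      ∑ k, ∑ a, (θ (J.embedding k a) - μ k) * v (J.embedding k a) := by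
  rw [inner_eq_sum_embedding J]
  simp only [PiLp.sub_apply, hJ.2]

theorem sum_mul_eq_inner {n : ℕ} {θ : EuclideanSpace ℝ (Fin n)} {J : Composition n}
    {μ : Fin J.length → ℝ} (hJ : IsConstantPieces (proj (monotoneCone n) θ) J μ)
    (k : Fin J.length) (w : Fin n → ℝ) :
    ∑ a, (θ (J.embedding k a) - μ k) * w (J.embedding k a) =
      inner ℝ (θ - proj (monotoneCone n) θ)
        (WithLp.toLp 2 fun i => if J.index i = k then w i else 0) := by
  rw [inner_sub_proj_eq_sum hJ, Finset.sum_eq_single k]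
  · simp
  · intro l _ hl
    simp [hl]
  · simp

theorem sum_block_sub_eq_zero {n : ℕ} {θ : EuclideanSpace ℝ (Fin n)} {J : Composition n}
    {μ : Fin J.length → ℝ} (hJ : IsConstantPieces (proj (monotoneCone n) θ) J μ)
    (k : Fin J.length) :
    ∑ a, (θ (J.embedding k a) - μ k) = 0 := by
  -- Shifting one constant piece by `t` of either sign is a feasible direction.
  have key : ∀ t : ℝ, (∑ a, (θ (J.embedding k a) - μ k)) * t ≤ 0 := by
    intro t
    rw [Finset.sum_mul, sum_mul_eq_inner hJ k fun _ => t]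
    refine inner_sub_proj_monotoneCone_nonpos fun i j _ h => ?_
    simp only [(hJ.index_eq_iff i j).2 h, le_refl]
  linarith [key 1, key (-1)]

theorem sum_block_tail_nonpos {n : ℕ} {θ : EuclideanSpace ℝ (Fin n)} {J : Composition n}
    {μ : Fin J.length → ℝ} (hJ : IsConstantPieces (proj (monotoneCone n) θ) J μ)
    (k : Fin J.length) (a : Fin (J.blocksFun k)) :
    ∑ b with a ≤ b, (θ (J.embedding k b) - μ k) ≤ 0 := by
  have h := sum_mul_eq_inner hJ k fun i => if J.embedding k a ≤ i then 1 else 0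
  simp only [OrderEmbedding.le_iff_le, mul_ite, mul_one, mul_zero] at h
  rw [Finset.sum_filter, h]
  refine inner_sub_proj_monotoneCone_nonpos fun i j hij h => ?_
  simp only [(hJ.index_eq_iff i j).2 h]
  by_cases hk : J.index j = k
  · by_cases hi : J.embedding k a ≤ i
    · simp [hi, hi.trans hij]
    · simp only [hk, hi, if_true, if_false]
      split_ifs <;> norm_num
  · simp [hk]

/-- The blockwise projection of `z` onto the block monotone cones of the partitions `I k`. -/
noncomputable def blockProj {n : ℕ} (J : Composition n)
    (I : (k : Fin J.length) → Composition (J.blocksFun k)) (z : EuclideanSpace ℝ (Fin n)) :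
    EuclideanSpace ℝ (Fin n) :=
  WithLp.toLp 2 fun i => proj (blockMonotoneCone (I (J.blocksFinEquiv.symm i).1))
    (restrict (J.embedding (J.blocksFinEquiv.symm i).1) z) (J.blocksFinEquiv.symm i).2

theorem blockProj_embedding {n : ℕ} (J : Composition n)
    (I : (k : Fin J.length) → Composition (J.blocksFun k)) (z : EuclideanSpace ℝ (Fin n))
    (k : Fin J.length) (a : Fin (J.blocksFun k)) :
    blockProj J I z (J.embedding k a) =
      proj (blockMonotoneCone (I k)) (restrict (J.embedding k) z) a := by
  have : J.blocksFinEquiv.symm (J.embedding k a) = ⟨k, a⟩ := by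
    rw [Equiv.symm_apply_eq]
    rfl
  simp only [blockProj]
  rw [this]

theorem norm_sq_blockProj {n : ℕ} (J : Composition n)
    (I : (k : Fin J.length) → Composition (J.blocksFun k)) (z : EuclideanSpace ℝ (Fin n)) :
    ‖blockProj J I z‖ ^ 2 =
      ∑ k, ‖proj (blockMonotoneCone (I k)) (restrict (J.embedding k) z)‖ ^ 2 := by
  rw [← real_inner_self_eq_norm_sq, inner_eq_sum_embedding J]
  refine Finset.sum_congr rfl fun k _ => ?_
  simp only [blockProj_embedding, EuclideanSpace.norm_sq_eq, Real.norm_eq_abs, sq_abs, ← sq]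

theorem inner_sub_blockProj_self {n : ℕ} (J : Composition n)
    (I : (k : Fin J.length) → Composition (J.blocksFun k)) (z : EuclideanSpace ℝ (Fin n)) :
    inner ℝ (z - blockProj J I z) (blockProj J I z) = 0 := by
  rw [inner_eq_sum_embedding J]
  refine Finset.sum_eq_zero fun k _ => ?_
  have := inner_sub_proj_self (zero_mem_blockMonotoneCone (I k)) (isClosed_blockMonotoneCone (I k))
    (convex_blockMonotoneCone (I k)) (add_mem_blockMonotoneCone (I k)) (restrict (J.embedding k) z)
  rw [PiLp.inner_apply] at this
  rw [← this]
  refine Finset.sum_congr rfl fun a _ => ?_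
  simp [blockProj_embedding, restrict, mul_comm]

theorem integral_norm_sq_blockProj {n : ℕ} (J : Composition n)
    (I : (k : Fin J.length) → Composition (J.blocksFun k)) :
    ∫ z, ‖blockProj J I z‖ ^ 2 ∂(stdGaussian (EuclideanSpace ℝ (Fin n))) =
      ∑ k, statDim (blockMonotoneCone (I k)) := by
  simp only [norm_sq_blockProj]
  rw [integral_finsetSum _ fun k _ => integrable_norm_sq_proj_restrict _ _]
  exact Finset.sum_congr rfl fun k _ => integral_norm_sq_proj_restrict _ _

theorem proj_restrict_mem {n : ℕ} (J : Composition n)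
    (I : (k : Fin J.length) → Composition (J.blocksFun k)) (z : EuclideanSpace ℝ (Fin n))
    (k : Fin J.length) :
    proj (blockMonotoneCone (I k)) (restrict (J.embedding k) z) ∈ blockMonotoneCone (I k) :=
  (proj_mem_isMinOn ⟨0, zero_mem_blockMonotoneCone (I k)⟩
    (isClosed_blockMonotoneCone (I k)) _).1

theorem inner_sub_proj_blockProj {n : ℕ} {θ : EuclideanSpace ℝ (Fin n)} {J : Composition n}
    {μ : Fin J.length → ℝ} (hJ : IsConstantPieces (proj (monotoneCone n) θ) J μ)
    {I : (k : Fin J.length) → Composition (J.blocksFun k)}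
    (hI : ∀ k, HasBlockMeans (fun a => θ (J.embedding k a)) (μ k) (I k))
    (z : EuclideanSpace ℝ (Fin n)) :
    inner ℝ (θ - proj (monotoneCone n) θ) (blockProj J I z) = 0 := by
  rw [inner_sub_proj_eq_sum hJ]
  refine Finset.sum_eq_zero fun k _ => ?_
  simp only [blockProj_embedding]
  exact sum_mul_eq_zero_of_mem_blockMonotoneCone (hI k) (proj_restrict_mem J I z k)

/-- Near `θ` the projection onto the monotone cone is, in the direction `z`, exactly affine. -/
theorem eventually_proj_add_smul {n : ℕ} {θ : EuclideanSpace ℝ (Fin n)} {J : Composition n}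
    {μ : Fin J.length → ℝ} (hJ : IsConstantPieces (proj (monotoneCone n) θ) J μ)
    {I : (k : Fin J.length) → Composition (J.blocksFun k)}
    (hI : ∀ k, IsFinestWithMean (fun a => θ (J.embedding k a)) (μ k) (I k))
    (z : EuclideanSpace ℝ (Fin n)) :
    ∀ᶠ σ : ℝ in 𝓝[>] 0, proj (monotoneCone n) (θ + σ • z) =
      proj (monotoneCone n) θ + σ • blockProj J I z := by
  have hmem := (proj_mem_isMinOn ⟨0, zero_mem_monotoneCone n⟩ (isClosed_monotoneCone n) θ).1
  have hblock : ∀ i j, i ≤ j → proj (monotoneCone n) θ i = proj (monotoneCone n) θ j →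
      blockProj J I z i ≤ blockProj J I z j := by
    intro i j hij h
    have hidx := (hJ.index_eq_iff i j).2 h
    obtain ⟨a, ha⟩ := exists_embedding_eq J i
    obtain ⟨b, hb⟩ := exists_embedding_eq J j
    rw [← ha, ← hb] at hij ⊢
    generalize J.index i = k at *
    subst hidx
    rw [blockProj_embedding, blockProj_embedding]
    exact (proj_restrict_mem J I z _).1 a b ((J.embedding _).le_iff_le.1 hij)
  have hev : ∀ᶠ σ : ℝ in 𝓝[>] 0, ∀ k, ∀ v : Fin (J.blocksFun k) → ℝ, Monotone v →
      ∑ a, (θ (J.embedding k a) - μ k + σ * (restrict (J.embedding k) z a -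
        proj (blockMonotoneCone (I k)) (restrict (J.embedding k) z) a)) * v a ≤ 0 :=
    eventually_all.2 fun k => eventually_sum_mul_nonpos (hI k) (sum_block_sub_eq_zero hJ k)
      (sum_block_tail_nonpos hJ k) _
  filter_upwards [hev, eventually_add_smul_mem_monotoneCone hmem hblock] with σ hσ hq
  refine proj_eq_of_inner_le_zero (isClosed_monotoneCone n) (convex_monotoneCone n) hq
    fun c hc => ?_
  -- Since the projection of `θ` is constant on each `J k`, the test vector is monotone there and
  -- the blockwise inequality applies.
  have h1 : inner ℝ (θ - proj (monotoneCone n) θ + σ • (z - blockProj J I z))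
      (c - proj (monotoneCone n) θ) ≤ 0 := by
    rw [inner_eq_sum_embedding J]
    refine Finset.sum_nonpos fun k _ => ?_
    have := hσ k (fun a => (c - proj (monotoneCone n) θ) (J.embedding k a)) (fun a b hab => by
      simpa [hJ.2] using hc _ _ ((J.embedding k).le_iff_le.2 hab))
    simpa [hJ.2, blockProj_embedding, restrict] using this
  have h2 := inner_sub_proj_blockProj hJ (fun k => (hI k).1) z
  have h3 := inner_sub_blockProj_self J I z
  generalize proj (monotoneCone n) θ = p at *
  generalize blockProj J I z = u at *
  have e1 : θ + σ • z - (p + σ • u) = θ - p + σ • (z - u) := by module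
  have e2 : c - (p + σ • u) = c - p - σ • u := by abel
  -- By `h2` and `h3` the residual is orthogonal to `u`, so the term `σ • u` drops out of the test
  -- vector.
  rw [e1, e2, inner_sub_right, inner_smul_right, inner_add_left _ _ u, inner_smul_left, h2, h3]
  simpa using h1

end Isotonic

theorem proposition1 (n : ℕ) (θ : EuclideanSpace ℝ (Fin n)) :
    (∃! J : Composition n, ∃ μ : Fin J.length → ℝ,
      IsConstantPieces (proj (monotoneCone n) θ) J μ) ∧
    ∀ (J : Composition n) (μ : Fin J.length → ℝ),
      IsConstantPieces (proj (monotoneCone n) θ) J μ →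
      (∀ k : Fin J.length, ∃! I : Composition (J.blocksFun k),
        IsFinestWithMean (fun a => θ (J.embedding k a)) (μ k) I) ∧
      ∀ I : (k : Fin J.length) → Composition (J.blocksFun k),
        (∀ k, IsFinestWithMean (fun a => θ (J.embedding k a)) (μ k) (I k)) →
        Tendsto (fun σ : ℝ => 1 / σ ^ 2 * excessRisk (monotoneCone n) θ σ) (𝓝[>] 0)
          (𝓝 (∑ k, statDim (blockMonotoneCone (I k)))) ∧
        Tendsto (fun σ : ℝ => 1 / σ ^ 2 * misspecifiedRisk (monotoneCone n) θ σ) (𝓝[>] 0)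
          (𝓝 (∑ k, statDim (blockMonotoneCone (I k)))) := by
  have hne : (monotoneCone n).Nonempty := ⟨0, zero_mem_monotoneCone n⟩
  have hcl := isClosed_monotoneCone n
  have hconv := convex_monotoneCone n
  refine ⟨existsUnique_isConstantPieces (proj_mem_isMinOn hne hcl θ).1, fun J μ hJ => ⟨fun k => ?_,
    fun I hI => ?_⟩⟩
  · obtain ⟨I, hI⟩ := exists_isFinestWithMean (sum_block_sub_eq_zero hJ k)
    exact ⟨I, hI, fun I' hI' => hI'.unique hI⟩
  · rw [← integral_norm_sq_blockProj J I]
    exact ⟨tendsto_excessRisk hne hcl hconv (eventually_proj_add_smul hJ hI)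
        (inner_sub_proj_blockProj hJ fun k => (hI k).1),
      tendsto_misspecifiedRisk hne hcl hconv (eventually_proj_add_smul hJ hI)⟩
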